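/- Let $\Theta\subset[0,\infty)\times[0,1]$ be a bounded set of parameters $\theta=(\lambda,p)$ (the parameter space), and let $G$ be a Borel probability distribution concentrated on $\Theta$ (the true mixing distribution). Given $\theta=(\lambda,p)$, let $K\sim\mathrm{Poisson}(\lambda)$ and let $X\mid K\sim\mathrm{Binomial}(K,p)$. Let $(X_i,K_i)$, $i=1,2,\dots$, be i.i.d., each with the law of $(X,K)$ when $\theta\sim G$. Put $W_{i1}=X_i$, $W_{i2}=K_i-X_i$ and $$\xi(\lambda,p)=(\xi_1,\xi_2)=(p\lambda,(1-p)\lambda),\qquad \Xi=\xi(\Theta),$$ and let $G_\xi$ be the distribution of $(\xi_1,\xi_2)$ when $(\lambda,p)\sim G$. For a probability distribution $H$ on $[0,\infty)^2$ let $$f_H(w_1,w_2)=\int \frac{e^{-\xi_1}\xi_1^{w_1}}{w_1!}\,\frac{e^{-\xi_2}\xi_2^{w_2}}{w_2!}\,dH(\xi_1,\xi_2),\qquad w_1,w_2\in\{0,1,2,\dots\},\quad 0^0=1.$$ A (Kiefer–Wolfowitz) generalized maximum likelihood estimator (GMLE) based on observations $w^1,\dots,w^n$ is a Borel probability distribution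 $\hat H$ concentrated on $\Xi$ that maximizes $\prod_{i=1}^n f_{H}(w^i)$ over all Borel probability distributions $H$ concentrated on $\Xi$. Theorem. (a) For every $(\lambda,p)\in[0,\infty)\times[0,1]$, conditionally on $(\lambda,p)$ the variables $X$ and $K-X$ are independent Poisson variables with means $\xi_1=p\lambda$ and $\xi_2=(1-p)\lambda$. (b) If $\Theta$ is closed, then for every $n$ and all $w^1,\dots,w^n\in\{0,1,2,\dots\}^2$ a GMLE exists. (c) With probability one, every sequence $(\hat G_{\xi,n})_{n\ge1}$ such that $\hat G_{\xi,n}$ is a GMLE based on $(W_{11},W_{12}),\dots,(W_{n1},W_{n2})$ for each $n\ge1$ converges weakly to $G_\xi$ as $n\to\infty$. -/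

import Mathlib

open MeasureTheory ProbabilityTheory Filter Topology
open scoped NNReal unitInterval

noncomputable section

namespace PoissonSampling

/-- The conditional law of `(X, K)` given `θ = (λ, p)`: `K` is Poisson with mean `λ`, and `X` given
`K = k` is binomial with parameters `k` and `p`. -/
def condLaw (θ : ℝ≥0 × I) : Measure (ℕ × ℕ) :=
  ((poissonMeasure θ.1) ⊗ₘ (⟨fun k ↦ binomial k θ.2, .of_discrete⟩ : Kernel ℕ ℕ)).map Prod.swap

lemma condLaw_singleton (θ : ℝ≥0 × I) (x k : ℕ) :
    condLaw θ {(x, k)} = poissonMeasure θ.1 {k} * binomial k θ.2 {x} := by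
  have : IsMarkovKernel (⟨fun k ↦ binomial k θ.2, .of_discrete⟩ : Kernel ℕ ℕ) :=
    ⟨fun k ↦ by change IsProbabilityMeasure (binomial k θ.2); infer_instance⟩
  have h : Prod.swap ⁻¹' {((x, k) : ℕ × ℕ)} = ({k} : Set ℕ) ×ˢ ({x} : Set ℕ) := by
    ext ⟨a, b⟩; simp [and_comm]
  rw [condLaw, Measure.map_apply measurable_swap .of_discrete, h,
    Measure.compProd_apply_prod .of_discrete .of_discrete, lintegral_singleton, mul_comm]
  rfl

lemma measurable_condLaw : Measurable condLaw := by
  refine Measure.measurable_of_measurable_coe _ fun s _ ↦ ?_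
  have h : (fun θ ↦ condLaw θ s) = fun θ ↦ ∑' y : ℕ × ℕ, s.indicator (fun y ↦ condLaw θ {y}) y := by
    ext θ
    exact (Measure.tsum_indicator_apply_singleton _ s .of_discrete).symm
  rw [h]
  refine Measurable.tsum fun y ↦ ?_
  by_cases hy : y ∈ s
  · simp only [Set.indicator_of_mem hy]
    obtain ⟨x, k⟩ := y
    simp only [condLaw_singleton, poissonMeasure_singleton, binomial_singleton]
    fun_prop
  · simp [Set.indicator_of_notMem hy]

/-- The law of `(X, K)` when `θ = (λ, p)` has the mixing distribution `G` and `(X, K)` has the law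
`condLaw θ` given `θ`. (By `measurable_condLaw` this mixture is well defined.) -/
def mixtureLaw (G : ProbabilityMeasure (ℝ≥0 × I)) : Measure (ℕ × ℕ) :=
  (G : Measure (ℝ≥0 × I)).bind condLaw

/-- The reparametrization `(λ, p) ↦ (ξ₁, ξ₂) = (p λ, (1 - p) λ)`. -/
def toXi (θ : ℝ≥0 × I) : ℝ≥0 × ℝ≥0 :=
  (unitInterval.toNNReal θ.2 * θ.1, unitInterval.toNNReal (unitInterval.symm θ.2) * θ.1)

lemma continuous_toXi : Continuous toXi := by
  unfold toXi
  fun_prop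

/-- The law of a pair of independent Poisson variables with means `ξ₁` and `ξ₂`. -/
def poissonPair (ξ : ℝ≥0 × ℝ≥0) : Measure (ℕ × ℕ) :=
  (poissonMeasure ξ.1).prod (poissonMeasure ξ.2)

/-- The mixture density (with respect to counting measure) `f_H(w) = ∫ f(w | ξ) dH(ξ)`. -/
def mixtureDensity (H : ProbabilityMeasure (ℝ≥0 × ℝ≥0)) (w : ℕ × ℕ) : ℝ :=
  ∫ ξ, (poissonPair ξ).real {w} ∂(H : Measure (ℝ≥0 × ℝ≥0))

/-- `H` is a Kiefer-Wolfowitz generalized maximum likelihood estimator of the mixing distribution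
of `(ξ₁, ξ₂)`, based on the sample `w`: it is concentrated on the parameter space `Ξ` and maximizes
the mixture likelihood among all probability distributions concentrated on `Ξ`. -/
def IsGMLE (Ξ : Set (ℝ≥0 × ℝ≥0)) {n : ℕ} (w : Fin n → ℕ × ℕ)
    (H : ProbabilityMeasure (ℝ≥0 × ℝ≥0)) : Prop :=
  (∀ᵐ ξ ∂(H : Measure (ℝ≥0 × ℝ≥0)), ξ ∈ Ξ) ∧
    ∀ H' : ProbabilityMeasure (ℝ≥0 × ℝ≥0), (∀ᵐ ξ ∂(H' : Measure (ℝ≥0 × ℝ≥0)), ξ ∈ Ξ) →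
      ∏ i, mixtureDensity H' (w i) ≤ ∏ i, mixtureDensity H (w i)

end PoissonSampling

end

/-!
Writing `K` as Poisson and `X` as a thinning of `K`, the joint probability of `X = x`, `K = x + y`
factors into two Poisson probabilities (`condLaw_eq_map_poissonPair`). The observations
`(X, K - X)` are thus drawn from the mixture density `f₀` of `G_ξ`.

A GMLE exists because the distributions carried by a compact set form a compact set in the weak
topology, and the likelihood is weakly continuous (`exists_isGMLE`).

Consistency avoids logarithms and rests on the first-order condition for the maximizer. Moving from
a GMLE `Ĥ` towards `G_ξ` cannot increase the likelihood, and so `∑ i, f₀ (w i) / f_Ĥ (w i) ≤ n`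
(`IsGMLE.sum_div_le`). With `pₙ` the empirical frequencies this says
`∑ w, pₙ w * f₀ w / f_Ĥ w ≤ 1`. By the law of large numbers `pₙ → f₀` almost surely, so every weak
cluster point `H` of a sequence of GMLEs satisfies `∑ w, f₀ w ^ 2 / f_H w ≤ 1`. The left side minus
one is the `χ²`-divergence of two probability mass functions, hence `f₀ = f_H`
(`eq_of_sum_sq_div_le_one`). The generating function of a mixture density is the Laplace transform
of its mixing distribution, and for bounded support it is entire. It therefore determines the
characteristic function, and `H = G_ξ` (`eq_of_mixtureDensity_eq`). By compactness a sequence with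
the single cluster point `G_ξ` converges to it (`tendsto_of_isGMLE`).
-/

namespace PoissonSampling

/-! ### Thinning of a Poisson variable -/

instance (ξ : ℝ≥0 × ℝ≥0) : IsProbabilityMeasure (poissonPair ξ) := by
  unfold poissonPair; infer_instance

lemma poissonPair_singleton (ξ : ℝ≥0 × ℝ≥0) (w : ℕ × ℕ) :
    poissonPair ξ {w} = poissonMeasure ξ.1 {w.1} * poissonMeasure ξ.2 {w.2} := by
  rw [poissonPair, ← Measure.prod_prod, Set.singleton_prod_singleton]

lemma poissonPair_real_singleton (ξ : ℝ≥0 × ℝ≥0) (w : ℕ × ℕ) :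
    (poissonPair ξ).real {w} =
      (Real.exp (-ξ.1) * (ξ.1 : ℝ) ^ w.1 / w.1.factorial) *
        (Real.exp (-ξ.2) * (ξ.2 : ℝ) ^ w.2 / w.2.factorial) := by
  rw [measureReal_def, poissonPair_singleton, ENNReal.toReal_mul, ← measureReal_def,
    ← measureReal_def, poissonMeasure_real_singleton, poissonMeasure_real_singleton]

lemma condLaw_eq_map_poissonPair (θ : ℝ≥0 × I) :
    condLaw θ = (poissonPair (toXi θ)).map (fun w ↦ (w.1, w.1 + w.2)) := by
  refine Measure.ext_of_singleton fun ⟨x, k⟩ ↦ ?_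
  rw [condLaw_singleton, Measure.map_apply .of_discrete .of_discrete]
  rcases le_or_gt x k with hxk | hxk
  · obtain ⟨y, rfl⟩ := Nat.exists_eq_add_of_le hxk
    have h : (fun w : ℕ × ℕ ↦ (w.1, w.1 + w.2)) ⁻¹' {(x, x + y)} = {(x, y)} := by
      ext ⟨a, b⟩
      simp only [Set.mem_preimage, Set.mem_singleton_iff, Prod.mk.injEq]
      omega
    have hp0 : (0 : ℝ) ≤ θ.2 := θ.2.2.1
    have hp1 : (0 : ℝ) ≤ 1 - θ.2 := sub_nonneg.2 θ.2.2.2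
    rw [h, poissonPair_singleton, binomial_singleton]
    simp only [poissonMeasure_singleton]
    rw [← ENNReal.ofReal_mul (by positivity), ← ENNReal.ofReal_mul (by positivity)]
    congr 1
    have hc : ((x + y).choose x : ℝ) * x.factorial * y.factorial = (x + y).factorial := by
      have := Nat.choose_mul_factorial_mul_factorial (Nat.le_add_right x y)
      rw [Nat.add_sub_cancel_left] at this
      exact_mod_cast this
    have he : Real.exp (-θ.1) =
        Real.exp (-(θ.2 * θ.1)) * Real.exp (-((1 - θ.2) * θ.1)) := by
      rw [← Real.exp_add]; congr 1; ring
    have h1 : (((toXi θ).1 : ℝ≥0) : ℝ) = θ.2 * θ.1 := rfl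
    have h2 : (((toXi θ).2 : ℝ≥0) : ℝ) = (1 - θ.2) * θ.1 := rfl
    rw [h1, h2, he, ← hc, Nat.add_sub_cancel_left, mul_pow, mul_pow, pow_add]
    have := Nat.factorial_ne_zero x
    have := Nat.factorial_ne_zero y
    have : ((x + y).choose x : ℝ) ≠ 0 := by
      exact_mod_cast (Nat.choose_pos (Nat.le_add_right x y)).ne'
    field_simp
  · have h : (fun w : ℕ × ℕ ↦ (w.1, w.1 + w.2)) ⁻¹' {(x, k)} = ∅ := by
      ext ⟨a, b⟩
      simp only [Set.mem_preimage, Set.mem_singleton_iff, Prod.mk.injEq, Set.mem_empty_iff_false,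
        iff_false]
      omega
    rw [h, measure_empty, binomial_singleton, Nat.choose_eq_zero_of_lt hxk]
    simp

lemma map_condLaw (θ : ℝ≥0 × I) :
    (condLaw θ).map (fun y ↦ (y.1, y.2 - y.1)) = poissonPair (toXi θ) := by
  rw [condLaw_eq_map_poissonPair, Measure.map_map .of_discrete .of_discrete]
  have h : (fun y : ℕ × ℕ ↦ (y.1, y.2 - y.1)) ∘ (fun w : ℕ × ℕ ↦ (w.1, w.1 + w.2)) = id := by
    ext w <;> simp
  rw [h, Measure.map_id]

/-! ### The mixture density -/

lemma continuous_poissonPair_real_singleton (w : ℕ × ℕ) :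
    Continuous fun ξ ↦ (poissonPair ξ).real {w} := by
  simp only [poissonPair_real_singleton]
  fun_prop

lemma integrable_poissonPair_real_singleton (μ : Measure (ℝ≥0 × ℝ≥0)) [IsFiniteMeasure μ]
    (w : ℕ × ℕ) : Integrable (fun ξ ↦ (poissonPair ξ).real {w}) μ :=
  .of_bound (continuous_poissonPair_real_singleton w).aestronglyMeasurable 1
    (.of_forall fun ξ ↦ by
      rw [Real.norm_of_nonneg measureReal_nonneg]; exact measureReal_le_one)

lemma mixtureDensity_nonneg (H : ProbabilityMeasure (ℝ≥0 × ℝ≥0)) (w : ℕ × ℕ) :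
    0 ≤ mixtureDensity H w :=
  integral_nonneg fun _ ↦ measureReal_nonneg

lemma continuous_mixtureDensity (w : ℕ × ℕ) : Continuous fun H ↦ mixtureDensity H w :=
  ProbabilityMeasure.continuous_integral_boundedContinuousFunction
    (BoundedContinuousFunction.ofNormedAddCommGroup (fun ξ ↦ (poissonPair ξ).real {w})
      (continuous_poissonPair_real_singleton w) 1 fun ξ ↦ by
        rw [Real.norm_of_nonneg measureReal_nonneg]; exact measureReal_le_one)

/-- On a mixture `(1 - ε) H + ε H'` of mixing distributions the density is the same mixture. -/
lemma exists_mixtureDensity_eq (H H' : ProbabilityMeasure (ℝ≥0 × ℝ≥0)) {S : Set (ℝ≥0 × ℝ≥0)}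
    (hH : ∀ᵐ ξ ∂(H : Measure (ℝ≥0 × ℝ≥0)), ξ ∈ S) (hH' : ∀ᵐ ξ ∂(H' : Measure (ℝ≥0 × ℝ≥0)), ξ ∈ S)
    {ε : ℝ} (h0 : 0 ≤ ε) (h1 : ε ≤ 1) :
    ∃ L : ProbabilityMeasure (ℝ≥0 × ℝ≥0), (∀ᵐ ξ ∂(L : Measure (ℝ≥0 × ℝ≥0)), ξ ∈ S) ∧
      ∀ w, mixtureDensity L w = (1 - ε) * mixtureDensity H w + ε * mixtureDensity H' w := by
  let ν : Measure (ℝ≥0 × ℝ≥0) := ENNReal.ofReal (1 - ε) • (H : Measure (ℝ≥0 × ℝ≥0)) +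
    ENNReal.ofReal ε • (H' : Measure (ℝ≥0 × ℝ≥0))
  have hν : IsProbabilityMeasure ν := ⟨by
    simp only [ν, Measure.add_apply, Measure.smul_apply, measure_univ, smul_eq_mul, mul_one]
    rw [← ENNReal.ofReal_add (by linarith) h0]; simp⟩
  refine ⟨⟨ν, hν⟩, ?_, fun w ↦ ?_⟩
  · change ∀ᵐ ξ ∂ν, ξ ∈ S
    rw [ae_add_measure_iff]
    exact ⟨Measure.ae_smul_measure hH _, Measure.ae_smul_measure hH' _⟩
  · change ∫ ξ, (poissonPair ξ).real {w} ∂ν = _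
    rw [integral_add_measure, integral_smul_measure, integral_smul_measure,
      ENNReal.toReal_ofReal (by linarith), ENNReal.toReal_ofReal h0]
    · rfl
    · exact (integrable_poissonPair_real_singleton _ w).smul_measure ENNReal.ofReal_ne_top
    · exact (integrable_poissonPair_real_singleton _ w).smul_measure ENNReal.ofReal_ne_top

lemma hasSum_mul_prod {f g : ℕ → ℂ} {a b : ℂ} (hf : HasSum f a) (hg : HasSum g b) :
    HasSum (fun w : ℕ × ℕ ↦ f w.1 * g w.2) (a * b) :=
  hf.mul hg (summable_mul_of_summable_norm hf.summable.norm hg.summable.norm)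

/-- The generating function of the mixture density is the Laplace transform of the mixing
distribution. The bound on the support makes it entire, so that it may be evaluated outside the
unit disc. -/
lemma hasSum_mixtureDensity_mul_pow {H : ProbabilityMeasure (ℝ≥0 × ℝ≥0)} {M : ℝ≥0}
    (hM : ∀ᵐ ξ ∂(H : Measure (ℝ≥0 × ℝ≥0)), ξ ∈ Set.Iic (M, M)) (s t : ℂ) :
    HasSum (fun w : ℕ × ℕ ↦ (mixtureDensity H w : ℂ) * (s ^ w.1 * t ^ w.2))
      (∫ ξ, Complex.exp ((s - 1) * (ξ.1 : ℝ) + (t - 1) * (ξ.2 : ℝ))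
        ∂(H : Measure (ℝ≥0 × ℝ≥0))) := by
  have key := hasSum_integral_of_dominated_convergence (μ := (H : Measure (ℝ≥0 × ℝ≥0)))
    (F := fun (w : ℕ × ℕ) ξ ↦ (((poissonPair ξ).real {w} : ℝ) : ℂ) * (s ^ w.1 * t ^ w.2))
    (f := fun ξ ↦ Complex.exp ((s - 1) * (ξ.1 : ℝ) + (t - 1) * (ξ.2 : ℝ)))
    (fun w _ ↦ ((M * ‖s‖) ^ w.1 / w.1.factorial) * ((M * ‖t‖) ^ w.2 / w.2.factorial))
    ?_ ?_ ?_ (integrable_const _) ?_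
  · refine key.congr_fun fun w ↦ ?_
    rw [integral_mul_const, mixtureDensity, integral_complex_ofReal]
  · intro w
    exact ((Complex.continuous_ofReal.comp (continuous_poissonPair_real_singleton w)).mul_const
      _).aestronglyMeasurable
  · intro w
    filter_upwards [hM] with ξ hξ
    have h (x : ℝ≥0) (hx : x ≤ M) (n : ℕ) :
        Real.exp (-x) * (x : ℝ) ^ n / n.factorial ≤ (M : ℝ) ^ n / n.factorial := by
      have hx' : (x : ℝ) ≤ M := hx
      gcongr
      exact (mul_le_of_le_one_left (by positivity) (by simp)).trans (by gcongr)
    rw [poissonPair_real_singleton, norm_mul, norm_mul, norm_pow, norm_pow, Complex.norm_real,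
      Real.norm_of_nonneg (by positivity)]
    calc _ ≤ ((M : ℝ) ^ w.1 / w.1.factorial * ((M : ℝ) ^ w.2 / w.2.factorial)) *
          (‖s‖ ^ w.1 * ‖t‖ ^ w.2) :=
          mul_le_mul_of_nonneg_right
            (mul_le_mul (h _ hξ.1 _) (h _ hξ.2 _) (by positivity) (by positivity))
            (by positivity)
      _ = _ := by rw [mul_pow, mul_pow]; ring
  · refine .of_forall fun ξ ↦ ?_
    exact (Real.summable_pow_div_factorial _).mul_of_nonneg (Real.summable_pow_div_factorial _)
      (fun n ↦ by positivity) fun n ↦ by positivity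
  · refine .of_forall fun ξ ↦ ?_
    have h (x : ℝ≥0) (s : ℂ) : HasSum (fun n : ℕ ↦
        ((Real.exp (-x) * (x : ℝ) ^ n / n.factorial : ℝ) : ℂ) * s ^ n)
        (Complex.exp ((s - 1) * (x : ℝ))) := by
      have := (NormedSpace.expSeries_div_hasSum_exp (s * (x : ℝ))).mul_left (Complex.exp (-(x : ℝ)))
      rw [← Complex.exp_eq_exp_ℂ, ← Complex.exp_add] at this
      rw [show (s - 1) * (x : ℝ) = -(x : ℝ) + s * (x : ℝ) by ring]
      refine this.congr_fun fun n ↦ ?_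
      push_cast
      rw [mul_pow]; ring
    have := hasSum_mul_prod (h ξ.1 s) (h ξ.2 t)
    rw [← Complex.exp_add] at this
    refine this.congr_fun fun w ↦ ?_
    rw [poissonPair_real_singleton]
    push_cast
    ring

/-- The mixture density is a probability mass function. -/
lemma hasSum_mixtureDensity {H : ProbabilityMeasure (ℝ≥0 × ℝ≥0)} {M : ℝ≥0}
    (hM : ∀ᵐ ξ ∂(H : Measure (ℝ≥0 × ℝ≥0)), ξ ∈ Set.Iic (M, M)) :
    HasSum (mixtureDensity H) 1 := by
  have := hasSum_mixtureDensity_mul_pow hM 1 1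
  simp only [sub_self, zero_mul, add_zero, Complex.exp_zero, one_pow, mul_one, integral_const,
    probReal_univ, one_smul] at this
  exact Complex.hasSum_ofReal.1 (by simpa using this)

/-- Identifiability of boundedly supported mixtures: evaluating the generating function of the
density at points of the line `1 + i ℝ` gives the characteristic function of the mixing
distribution. -/
lemma eq_of_mixtureDensity_eq {H H' : ProbabilityMeasure (ℝ≥0 × ℝ≥0)} {M : ℝ≥0}
    (hH : ∀ᵐ ξ ∂(H : Measure (ℝ≥0 × ℝ≥0)), ξ ∈ Set.Iic (M, M))
    (hH' : ∀ᵐ ξ ∂(H' : Measure (ℝ≥0 × ℝ≥0)), ξ ∈ Set.Iic (M, M))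
    (h : mixtureDensity H = mixtureDensity H') : H = H' := by
  have hemb : MeasurableEmbedding (Prod.map ((↑) : ℝ≥0 → ℝ) ((↑) : ℝ≥0 → ℝ)) :=
    (NNReal.isClosedEmbedding_coe.prodMap NNReal.isClosedEmbedding_coe).measurableEmbedding
  apply Subtype.ext
  apply hemb.map_injective
  change (H : Measure (ℝ≥0 × ℝ≥0)).map _ = (H' : Measure (ℝ≥0 × ℝ≥0)).map _
  have := Measure.isProbabilityMeasure_map (μ := (H : Measure (ℝ≥0 × ℝ≥0)))
    hemb.measurable.aemeasurable
  have := Measure.isProbabilityMeasure_map (μ := (H' : Measure (ℝ≥0 × ℝ≥0)))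
    hemb.measurable.aemeasurable
  refine Measure.ext_of_charFunDual (funext fun L ↦ ?_)
  simp only [charFunDual_apply]
  rw [hemb.integral_map, hemb.integral_map]
  have e (ξ : ℝ≥0 × ℝ≥0) :
      (L (Prod.map ((↑) : ℝ≥0 → ℝ) ((↑) : ℝ≥0 → ℝ) ξ) : ℂ) * Complex.I =
      ((1 + L (1, 0) * Complex.I) - 1) * (ξ.1 : ℝ) +
        ((1 + L (0, 1) * Complex.I) - 1) * (ξ.2 : ℝ) := by
    have : Prod.map ((↑) : ℝ≥0 → ℝ) ((↑) : ℝ≥0 → ℝ) ξ =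
        (ξ.1 : ℝ) • ((1 : ℝ), (0 : ℝ)) + (ξ.2 : ℝ) • ((0 : ℝ), (1 : ℝ)) := by
      ext <;> simp
    rw [this, map_add, map_smul, map_smul]
    push_cast
    simp only [smul_eq_mul, Complex.ofReal_mul]
    ring
  simp only [e]
  refine HasSum.unique (hasSum_mixtureDensity_mul_pow hH _ _) ?_
  rw [h]
  exact hasSum_mixtureDensity_mul_pow hH' _ _

end PoissonSampling

namespace PoissonSampling

/-! ### Likelihood comparison -/

/-- If moving from `a` towards `b` does not increase `∏ i, a i`, then the directional derivative
`∑ i, (b i / a i - 1)` of the logarithm of the product is nonpositive. -/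
lemma sum_div_le_card_of_prod_le {ι : Type*} [Fintype ι] {a b : ι → ℝ} (ha : ∀ i, 0 < a i)
    (h : ∀ ε : ℝ, 0 ≤ ε → ε ≤ 1 → ∏ i, ((1 - ε) * a i + ε * b i) ≤ ∏ i, a i) :
    ∑ i, b i / a i ≤ Fintype.card ι := by
  classical
  set φ : ℝ → ℝ := fun ε ↦ ∏ i, (1 + ε * (b i / a i - 1)) with hφ
  have hφ0 : φ 0 = 1 := by simp [hφ]
  have hφ1 (ε : ℝ) (h0 : 0 < ε) (h1 : ε < 1) : φ ε ≤ 1 := by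
    have e : ∏ i, ((1 - ε) * a i + ε * b i) = (∏ i, a i) * φ ε := by
      rw [hφ, ← Finset.prod_mul_distrib]
      refine Finset.prod_congr rfl fun i _ ↦ ?_
      have := (ha i).ne'
      field_simp
      ring
    have hpos : 0 < ∏ i, a i := Finset.prod_pos fun i _ ↦ ha i
    have := h ε h0.le h1.le
    rw [e] at this
    exact le_of_mul_le_mul_left (by simpa using this) hpos
  have hd : HasDerivAt φ (∑ i, (b i / a i - 1)) 0 := by
    have := HasDerivAt.fun_finsetProd (u := Finset.univ) (x := (0 : ℝ))
      (f := fun i (ε : ℝ) ↦ 1 + ε * (b i / a i - 1)) (f' := fun i ↦ b i / a i - 1)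
      (fun i _ ↦ by simpa using ((hasDerivAt_id (0 : ℝ)).mul_const (b i / a i - 1)).const_add 1)
    simpa using this
  have hle : ∑ i, (b i / a i - 1) ≤ 0 := by
    refine le_of_tendsto ((hasDerivWithinAt_iff_tendsto_slope' (s := Set.Ioi 0) (by simp)).1
      hd.hasDerivWithinAt) ?_
    filter_upwards [Ioo_mem_nhdsGT (zero_lt_one' ℝ)] with ε hε
    rw [slope_def_field, hφ0, sub_zero]
    exact div_nonpos_of_nonpos_of_nonneg (sub_nonpos.2 (hφ1 ε hε.1 hε.2)) hε.1.le
  simpa using hle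

/-- The first-order optimality condition satisfied by a GMLE. -/
lemma IsGMLE.sum_div_le {Ξ : Set (ℝ≥0 × ℝ≥0)} {n : ℕ} {w : Fin n → ℕ × ℕ}
    {H H' : ProbabilityMeasure (ℝ≥0 × ℝ≥0)} (hH : IsGMLE Ξ w H)
    (hH' : ∀ᵐ ξ ∂(H' : Measure (ℝ≥0 × ℝ≥0)), ξ ∈ Ξ) (hpos : ∀ i, 0 < mixtureDensity H (w i)) :
    ∑ i, mixtureDensity H' (w i) / mixtureDensity H (w i) ≤ n := by
  have := sum_div_le_card_of_prod_le (b := fun i ↦ mixtureDensity H' (w i)) hpos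
    fun ε h0 h1 ↦ by
      obtain ⟨L, hL, hLw⟩ := exists_mixtureDensity_eq H H' hH.1 hH' h0 h1
      simpa only [hLw] using hH.2 L hL
  simpa using this

lemma IsGMLE.mixtureDensity_pos {Ξ : Set (ℝ≥0 × ℝ≥0)} {n : ℕ} {w : Fin n → ℕ × ℕ}
    {H H' : ProbabilityMeasure (ℝ≥0 × ℝ≥0)} (hH : IsGMLE Ξ w H)
    (hH' : ∀ᵐ ξ ∂(H' : Measure (ℝ≥0 × ℝ≥0)), ξ ∈ Ξ) (hpos : ∀ i, 0 < mixtureDensity H' (w i))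
    (i : Fin n) : 0 < mixtureDensity H (w i) := by
  refine (mixtureDensity_nonneg _ _).lt_of_ne' fun h0 ↦ ?_
  have h := hH.2 H' hH'
  rw [Finset.prod_eq_zero (f := fun i ↦ mixtureDensity H (w i)) (Finset.mem_univ i) h0] at h
  exact absurd (Finset.prod_pos fun i _ ↦ hpos i) h.not_gt

/-- The `χ²`-divergence `∑ f ^ 2 / g - 1` of probability mass functions is nonnegative, and it
vanishes only if they agree. -/
lemma eq_of_sum_sq_div_le_one {ι : Type*} {f g : ι → ℝ} (hf : ∀ w, 0 ≤ f w) (hg : ∀ w, 0 ≤ g w)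
    (hf1 : HasSum f 1) (hg1 : HasSum g 1) (hfg : ∀ w, 0 < f w → 0 < g w)
    (h : ∀ F : Finset ι, ∑ w ∈ F, f w ^ 2 / g w ≤ 1) : f = g := by
  have hq (w : ι) : 0 ≤ f w ^ 2 / g w := div_nonneg (sq_nonneg _) (hg w)
  have hs : Summable fun w ↦ f w ^ 2 / g w := summable_of_sum_le hq h
  have hle : ∑' w, f w ^ 2 / g w ≤ 1 := hs.tsum_le_of_sum_le h
  have hsum := (hs.hasSum.sub (hf1.mul_left 2)).add hg1
  have hcases (w : ι) : (f w = 0 ∧ g w = 0) ∨ 0 < g w := by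
    rcases (hg w).eq_or_lt with h0 | h0
    · exact .inl ⟨le_antisymm (not_lt.1 fun hc ↦ (hfg w hc).ne h0) (hf w), h0.symm⟩
    · exact .inr h0
  have hsq (w : ι) (h0 : 0 < g w) :
      f w ^ 2 / g w - 2 * f w + g w = (f w - g w) ^ 2 / g w := by field_simp; ring
  have hnn (w : ι) : 0 ≤ f w ^ 2 / g w - 2 * f w + g w := by
    rcases hcases w with ⟨h1, h2⟩ | h0
    · simp [h1, h2]
    · rw [hsq w h0]; positivity
  have hzero := (hasSum_zero_iff_of_nonneg hnn).1 <| by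
    have : ∑' w, f w ^ 2 / g w - 2 * 1 + 1 = 0 :=
      le_antisymm (by linarith) (hsum.nonneg hnn)
    rwa [this] at hsum
  ext w
  rcases hcases w with ⟨h1, h2⟩ | h0
  · rw [h1, h2]
  · have := congr_fun hzero w
    simp only [Pi.zero_apply] at this
    rw [hsq w h0, div_eq_zero_iff, sq_eq_zero_iff, sub_eq_zero] at this
    exact this.resolve_right h0.ne'

/-! ### Compactness, existence of a GMLE, and the support of an image measure -/

lemma isCompact_setOf_ae_mem {E : Type*} [TopologicalSpace E] [T2Space E] [NormalSpace E]
    [MeasurableSpace E] [BorelSpace E] {K : Set E} (hK : IsCompact K) :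
    IsCompact {H : ProbabilityMeasure E | ∀ᵐ ξ ∂(H : Measure E), ξ ∈ K} := by
  have := isCompact_setOfPred_probabilityMeasure_mass_eq_compl_isCompact_le (E := E)
    (u := fun _ ↦ 0) (K := fun _ ↦ K) tendsto_const_nhds (fun _ ↦ hK) (.inl inferInstance)
  convert this using 1
  ext H
  simp only [Set.mem_ofPred_eq, forall_const, nonpos_iff_eq_zero]
  rw [ProbabilityMeasure.null_iff_toMeasure_null, ae_iff]
  rfl

lemma exists_isGMLE {Ξ : Set (ℝ≥0 × ℝ≥0)} (hΞ : IsCompact Ξ) (hne : Ξ.Nonempty) {n : ℕ}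
    (w : Fin n → ℕ × ℕ) : ∃ H, IsGMLE Ξ w H := by
  obtain ⟨ξ, hξ⟩ := hne
  obtain ⟨H, hH, hmax⟩ := (isCompact_setOf_ae_mem hΞ).exists_isMaxOn
    ⟨⟨Measure.dirac ξ, inferInstance⟩, by
      change ∀ᵐ y ∂(Measure.dirac ξ), y ∈ Ξ
      exact (ae_dirac_iff (p := (· ∈ Ξ)) hΞ.measurableSet).2 hξ⟩
    (continuous_finsetProd Finset.univ
      fun i _ ↦ continuous_mixtureDensity (w i)).continuousOn
  exact ⟨H, hH, fun H' hH' ↦ hmax hH'⟩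

/-- Neither `S` nor its image is assumed measurable. The measure is carried up to `ε` by a compact
subset of `S`, whose image is compact, hence measurable. -/
lemma ae_map_mem_image {E F : Type*} [TopologicalSpace E] [PolishSpace E] [MeasurableSpace E]
    [BorelSpace E] [TopologicalSpace F] [T2Space F] [MeasurableSpace F] [BorelSpace F]
    {f : E → F} (hf : Continuous f) {μ : Measure E} [IsFiniteMeasure μ] {S : Set E}
    (hS : ∀ᵐ x ∂μ, x ∈ S) : ∀ᵐ y ∂(μ.map f), y ∈ f '' S := by
  let := TopologicalSpace.upgradeIsCompletelyMetrizable E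
  set A := (toMeasurable μ Sᶜ)ᶜ with hA
  have hAm : MeasurableSet A := (measurableSet_toMeasurable _ _).compl
  have hAS : A ⊆ S := Set.compl_subset_comm.1 (subset_toMeasurable μ Sᶜ)
  have hAc : μ Aᶜ = 0 := by rw [hA, compl_compl, measure_toMeasurable]; exact hS
  rw [ae_iff]
  refine nonpos_iff_eq_zero.1 (ENNReal.le_of_forall_pos_le_add fun ε hε _ ↦ ?_)
  obtain ⟨K, hKA, hK, hlt⟩ := hAm.exists_isCompact_sdiff_lt (measure_ne_top μ A)
    (ENNReal.coe_pos.2 hε).ne'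
  have hfK : MeasurableSet (f '' K) := (hK.image hf).measurableSet
  calc μ.map f {y | ¬ y ∈ f '' S} ≤ μ.map f (f '' K)ᶜ :=
        measure_mono (Set.compl_subset_compl.2 (Set.image_mono (hKA.trans hAS)))
    _ = μ (f ⁻¹' (f '' K)ᶜ) := Measure.map_apply hf.measurable hfK.compl
    _ ≤ μ (Aᶜ ∪ A \ K) := measure_mono fun x hx ↦ by
        by_cases hxA : x ∈ A
        · exact .inr ⟨hxA, fun hxK ↦ hx (Set.mem_image_of_mem f hxK)⟩
        · exact .inl hxA
    _ ≤ μ Aᶜ + μ (A \ K) := measure_union_le _ _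
    _ ≤ 0 + ε := by rw [hAc]; gcongr

/-! ### Consistency -/

/-- Along a sample whose empirical frequencies converge to the density of `G₀`, every sequence of
GMLEs converges weakly to `G₀`. -/
lemma tendsto_of_isGMLE {Ξ : Set (ℝ≥0 × ℝ≥0)} {M : ℝ≥0} (hM : Ξ ⊆ Set.Iic (M, M))
    {G₀ : ProbabilityMeasure (ℝ≥0 × ℝ≥0)} (hG₀ : ∀ᵐ ξ ∂(G₀ : Measure (ℝ≥0 × ℝ≥0)), ξ ∈ Ξ)
    {W : ℕ → ℕ × ℕ} (hpos : ∀ i, 0 < mixtureDensity G₀ (W i))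
    (hfreq : ∀ w, Tendsto
      (fun n : ℕ ↦ (∑ i ∈ Finset.range n, Set.indicator {w} (1 : ℕ × ℕ → ℝ) (W i)) / n) atTop
      (𝓝 (mixtureDensity G₀ w)))
    {Ghat : ℕ → ProbabilityMeasure (ℝ≥0 × ℝ≥0)}
    (hG : ∀ n : ℕ, 1 ≤ n → IsGMLE Ξ (fun i : Fin n ↦ W i) (Ghat n)) :
    Tendsto Ghat atTop (𝓝 G₀) := by
  have hG₀M : ∀ᵐ ξ ∂(G₀ : Measure (ℝ≥0 × ℝ≥0)), ξ ∈ Set.Iic (M, M) := hG₀.mono fun _ h ↦ hM h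
  have hK : IsCompact (Set.Iic ((M, M) : ℝ≥0 × ℝ≥0)) := by
    rw [← Set.Icc_bot]; exact isCompact_Icc
  refine (isCompact_setOf_ae_mem hK).tendsto_nhds_of_unique_mapClusterPt
    (eventually_atTop.2 ⟨1, fun n hn ↦ (hG n hn).1.mono fun _ h ↦ hM h⟩) fun H hH hcl ↦ ?_
  obtain ⟨U, hU, hUH⟩ := mapClusterPt_iff_ultrafilter.1 hcl
  set p : ℕ → ℕ × ℕ → ℝ := fun n w ↦
    (∑ i ∈ Finset.range n, Set.indicator {w} (1 : ℕ × ℕ → ℝ) (W i)) / n with hp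
  have hpU (w : ℕ × ℕ) : Tendsto (fun n ↦ p n w) U (𝓝 (mixtureDensity G₀ w)) :=
    (hfreq w).mono_left hU
  have hdU (w : ℕ × ℕ) : Tendsto (fun n ↦ mixtureDensity (Ghat n) w) U (𝓝 (mixtureDensity H w)) :=
    ((continuous_mixtureDensity w).tendsto H).comp hUH
  have h1U : ∀ᶠ n in (U : Filter ℕ), 1 ≤ n := hU (eventually_ge_atTop 1)
  have hp0 (n : ℕ) (w : ℕ × ℕ) : 0 ≤ p n w :=
    div_nonneg (Finset.sum_nonneg fun i _ ↦ Set.indicator_nonneg (by simp) _) n.cast_nonneg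
  -- the optimality condition, with equal observations grouped
  have hopt (n : ℕ) (hn : 1 ≤ n) (F : Finset (ℕ × ℕ)) :
      ∑ w ∈ F, p n w * (mixtureDensity G₀ w / mixtureDensity (Ghat n) w) ≤ 1 := by
    have hn0 : (0 : ℝ) < n := by exact_mod_cast hn
    have hGpos := (hG n hn).mixtureDensity_pos hG₀ fun i ↦ hpos i
    have hle := (hG n hn).sum_div_le hG₀ hGpos
    rw [Fin.sum_univ_eq_sum_range
      (fun i ↦ mixtureDensity G₀ (W i) / mixtureDensity (Ghat n) (W i))] at hle
    calc ∑ w ∈ F, p n w * (mixtureDensity G₀ w / mixtureDensity (Ghat n) w)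
        = (∑ i ∈ Finset.range n, ∑ w ∈ F, Set.indicator {w} (1 : ℕ × ℕ → ℝ) (W i) *
            (mixtureDensity G₀ w / mixtureDensity (Ghat n) w)) / n := by
          rw [Finset.sum_comm, Finset.sum_div]
          refine Finset.sum_congr rfl fun w _ ↦ ?_
          rw [hp, ← Finset.sum_mul]
          ring
      _ ≤ (∑ i ∈ Finset.range n, mixtureDensity G₀ (W i) / mixtureDensity (Ghat n) (W i)) / n := by
          gcongr with i hi
          have e (w : ℕ × ℕ) : Set.indicator {w} (1 : ℕ × ℕ → ℝ) (W i) *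
              (mixtureDensity G₀ w / mixtureDensity (Ghat n) w) =
              if W i = w then mixtureDensity G₀ (W i) / mixtureDensity (Ghat n) (W i) else 0 := by
            by_cases h : W i = w <;> simp [h]
          simp only [e, Finset.sum_ite_eq]
          split_ifs
          · exact le_rfl
          · exact div_nonneg (mixtureDensity_nonneg _ _) (mixtureDensity_nonneg _ _)
      _ ≤ 1 := by rwa [div_le_one hn0]
  -- the limit density is positive where `f₀` is: otherwise the ratio `f₀ / f_Ĝ` would blow up
  have hsq (w : ℕ × ℕ) : mixtureDensity G₀ w * mixtureDensity G₀ w ≤ mixtureDensity H w := by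
    refine le_of_tendsto_of_tendsto ((hpU w).mul_const _) (hdU w) (h1U.mono fun n hn ↦ ?_)
    change p n w * mixtureDensity G₀ w ≤ mixtureDensity (Ghat n) w
    by_cases hw : ∃ i < n, W i = w
    · obtain ⟨i, hi, rfl⟩ := hw
      have h0 := (hG n hn).mixtureDensity_pos hG₀ (fun i ↦ hpos i) ⟨i, hi⟩
      have := hopt n hn {W i}
      rw [Finset.sum_singleton, mul_div_assoc', div_le_one h0] at this
      exact this
    · have : p n w = 0 := by
        rw [hp]
        simp only
        rw [Finset.sum_eq_zero, zero_div]
        intro i hi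
        exact Set.indicator_of_notMem (s := {w})
          (fun h ↦ hw ⟨i, Finset.mem_range.1 hi, h⟩) (1 : ℕ × ℕ → ℝ)
      rw [this, zero_mul]
      exact mixtureDensity_nonneg _ _
  have hposH (w : ℕ × ℕ) (h : 0 < mixtureDensity G₀ w) : 0 < mixtureDensity H w :=
    (mul_pos h h).trans_le (hsq w)
  refine (eq_of_mixtureDensity_eq hG₀M hH ?_).symm
  refine eq_of_sum_sq_div_le_one (mixtureDensity_nonneg _) (mixtureDensity_nonneg _)
    (hasSum_mixtureDensity hG₀M) (hasSum_mixtureDensity hH) hposH fun F ↦ ?_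
  refine le_of_tendsto (f := fun n ↦
    ∑ w ∈ F, p n w * (mixtureDensity G₀ w / mixtureDensity (Ghat n) w))
    (tendsto_finsetSum F fun w _ ↦ ?_) (h1U.mono fun n hn ↦ hopt n hn F)
  rcases (mixtureDensity_nonneg G₀ w).eq_or_lt with h0 | h0
  · simp [← h0]
  · rw [sq, mul_div_assoc]
    exact (hpU w).mul (tendsto_const_nhds.div (hdU w) (hposH w h0).ne')

/-- The law of `(X, K - X)` under the mixture has the mixture density of the law of `(ξ₁, ξ₂)`. -/
lemma map_mixtureLaw_real_singleton (G : ProbabilityMeasure (ℝ≥0 × I)) (w : ℕ × ℕ) :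
    ((mixtureLaw G).map (fun y ↦ (y.1, y.2 - y.1))).real {w} =
      mixtureDensity (G.map continuous_toXi.measurable.aemeasurable) w := by
  change _ = ∫ ξ, (poissonPair ξ).real {w} ∂((G : Measure (ℝ≥0 × I)).map toXi)
  rw [measureReal_def, Measure.map_apply .of_discrete .of_discrete, mixtureLaw,
    Measure.bind_apply .of_discrete measurable_condLaw.aemeasurable,
    integral_map continuous_toXi.aemeasurable
      (continuous_poissonPair_real_singleton w).aestronglyMeasurable,
    integral_eq_lintegral_of_nonneg_ae (.of_forall fun _ ↦ measureReal_nonneg)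
      ((continuous_poissonPair_real_singleton w).comp continuous_toXi).aestronglyMeasurable]
  congr 1
  refine lintegral_congr fun θ ↦ ?_
  rw [ofReal_measureReal, ← map_condLaw, Measure.map_apply .of_discrete .of_discrete]

/-- The strong law of large numbers for the empirical frequencies of a discrete sample. -/
lemma ae_tendsto_frequency {Ω S : Type*} [MeasurableSpace Ω] {P : Measure Ω}
    [IsProbabilityMeasure P] [MeasurableSpace S] [Countable S] [DiscreteMeasurableSpace S]
    {W : ℕ → Ω → S} {μ : Measure S} (hindep : iIndepFun W P) (hlaw : ∀ i, HasLaw (W i) μ P) :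
    ∀ᵐ ω ∂P, ∀ w, Tendsto
      (fun n : ℕ ↦ (∑ i ∈ Finset.range n, Set.indicator {w} (1 : S → ℝ) (W i ω)) / n) atTop
      (𝓝 (μ.real {w})) := by
  refine ae_all_iff.2 fun w ↦ ?_
  have hm : Measurable (Set.indicator {w} (1 : S → ℝ)) := .of_discrete
  have h := strong_law_ae_real (μ := P) (fun i ω ↦ Set.indicator {w} (1 : S → ℝ) (W i ω))
    (.of_bound (hm.comp_aemeasurable (hlaw 0).aemeasurable).aestronglyMeasurable 1
      (.of_forall fun ω ↦ by
        by_cases hω : W 0 ω = w <;> simp [hω]))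
    (fun i j hij ↦ (hindep.indepFun hij).comp hm hm)
    (fun i ↦ (IdentDistrib.mk (hlaw i).aemeasurable (hlaw 0).aemeasurable
      ((hlaw i).map_eq.trans (hlaw 0).map_eq.symm)).comp hm)
  have e : ∫ ω, Set.indicator {w} (1 : S → ℝ) (W 0 ω) ∂P = μ.real {w} := by
    rw [← integral_map (f := Set.indicator {w} (1 : S → ℝ)) (hlaw 0).aemeasurable
      hm.aestronglyMeasurable, (hlaw 0).map_eq, integral_indicator_one .of_discrete]
  rwa [e] at h

/-- Almost surely, no value of probability zero is observed. -/
lemma ae_forall_measureReal_singleton_pos {Ω S : Type*} [MeasurableSpace Ω] {P : Measure Ω}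
    [MeasurableSpace S] [Countable S] [DiscreteMeasurableSpace S]
    {W : ℕ → Ω → S} {μ : Measure S} [IsFiniteMeasure μ] (hlaw : ∀ i, HasLaw (W i) μ P) :
    ∀ᵐ ω ∂P, ∀ i, 0 < μ.real {W i ω} := by
  refine ae_all_iff.2 fun i ↦ ?_
  have h : ∀ᵐ x ∂μ, 0 < μ.real {x} := by
    rw [ae_iff_of_countable]
    exact fun x hx ↦ ENNReal.toReal_pos hx (measure_ne_top _ _)
  rw [← (hlaw i).map_eq] at h
  have := ae_of_ae_map (hlaw i).aemeasurable h
  rwa [(hlaw i).map_eq] at this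

end PoissonSampling

/-! ### Existence and consistency of the GMLE under Poisson sampling -/

theorem mainTheorem1 {Ω : Type*} [MeasurableSpace Ω] (P : Measure Ω) [IsProbabilityMeasure P]
    -- the parameter space of `(λ, p)`, assumed bounded, and the true mixing distribution on it
    (Θ : Set (ℝ≥0 × I)) (hΘ : Bornology.IsBounded Θ)
    (G : ProbabilityMeasure (ℝ≥0 × I)) (hG : ∀ᵐ θ ∂(G : Measure (ℝ≥0 × I)), θ ∈ Θ)
    -- i.i.d. observations `(X i, K i)` from the mixture
    (X K : ℕ → Ω → ℕ)
    (hindep : iIndepFun (fun i ω ↦ (X i ω, K i ω)) P)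
    (hlaw : ∀ i, HasLaw (fun ω ↦ (X i ω, K i ω)) (PoissonSampling.mixtureLaw G) P) :
    -- given `(λ, p)`, `(X, K - X)` is a pair of independent Poissons with means `pλ`, `(1 - p)λ`
    (∀ θ : ℝ≥0 × I,
      (PoissonSampling.condLaw θ).map (fun y ↦ (y.1, y.2 - y.1)) =
        PoissonSampling.poissonPair (PoissonSampling.toXi θ)) ∧
    -- a GMLE exists as soon as the parameter space is closed
    (IsClosed Θ → ∀ (n : ℕ) (w : Fin n → ℕ × ℕ),
      ∃ H, PoissonSampling.IsGMLE (PoissonSampling.toXi '' Θ) w H) ∧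
    -- almost surely, every sequence of GMLEs converges weakly to the law of `(ξ₁, ξ₂)` under `G`
    (∀ᵐ ω ∂P, ∀ Ghat : ℕ → ProbabilityMeasure (ℝ≥0 × ℝ≥0),
      (∀ n : ℕ, 1 ≤ n →
        PoissonSampling.IsGMLE (PoissonSampling.toXi '' Θ)
          (fun i : Fin n ↦ (X i ω, K i ω - X i ω)) (Ghat n)) →
      Tendsto Ghat atTop
        (𝓝 (G.map PoissonSampling.continuous_toXi.measurable.aemeasurable))) := by
  obtain ⟨M, hM⟩ : ∃ M : ℝ≥0, PoissonSampling.toXi '' Θ ⊆ Set.Iic (M, M) := by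
    obtain ⟨c, hc⟩ := ((hΘ.isCompact_closure.image PoissonSampling.continuous_toXi).isBounded.subset
      (Set.image_mono subset_closure)).bddAbove
    exact ⟨max c.1 c.2, fun ξ hξ ↦
      ⟨(hc hξ).1.trans (le_max_left _ _), (hc hξ).2.trans (le_max_right _ _)⟩⟩
  refine ⟨PoissonSampling.map_condLaw, fun hcl n w ↦ ?_, ?_⟩
  · have hne : Θ.Nonempty := hG.exists
    exact PoissonSampling.exists_isGMLE
      ((Metric.isCompact_of_isClosed_isBounded hcl hΘ).image PoissonSampling.continuous_toXi)
      (hne.image _) w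
  have hG₀ : ∀ᵐ ξ ∂((G.map PoissonSampling.continuous_toXi.measurable.aemeasurable :
      ProbabilityMeasure (ℝ≥0 × ℝ≥0)) : Measure (ℝ≥0 × ℝ≥0)), ξ ∈ PoissonSampling.toXi '' Θ :=
    PoissonSampling.ae_map_mem_image PoissonSampling.continuous_toXi hG
  set W : ℕ → Ω → ℕ × ℕ := fun i ω ↦ (X i ω, K i ω - X i ω)
  set φ : ℕ × ℕ → ℕ × ℕ := fun y ↦ (y.1, y.2 - y.1) with hφ
  have hφm : Measurable φ := .of_discrete
  have hWindep : iIndepFun W P := hindep.comp (fun _ ↦ φ) fun _ ↦ hφm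
  have hWlaw (i : ℕ) : HasLaw (W i) ((PoissonSampling.mixtureLaw G).map φ) P :=
    ⟨hφm.comp_aemeasurable (hlaw i).aemeasurable, by
      rw [← (hlaw i).map_eq, AEMeasurable.map_map_of_aemeasurable hφm.aemeasurable
        (hlaw i).aemeasurable]; rfl⟩
  have : IsProbabilityMeasure ((PoissonSampling.mixtureLaw G).map φ) := by
    rw [← (hWlaw 0).map_eq]
    exact Measure.isProbabilityMeasure_map (hWlaw 0).aemeasurable
  filter_upwards [PoissonSampling.ae_tendsto_frequency hWindep hWlaw,
    PoissonSampling.ae_forall_measureReal_singleton_pos hWlaw] with ω hfreq hpos Ghat hGhat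
  simp only [hφ, PoissonSampling.map_mixtureLaw_real_singleton] at hfreq hpos
  exact PoissonSampling.tendsto_of_isGMLE hM hG₀ hpos hfreq hGhat
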